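/- **Theorem (Pointwise asymptotic normality).** Let $T_{pre},T_{post}\in\mathbb{N}_0$ and let $(Y_1,D_1),(Y_2,D_2),\dots$ be i.i.d. copies of $(Y,D)$, where $Y=\{Y(t):t\in[-T_{pre},T_{post}]\}$ is a real-valued stochastic process and $D\in\{0,1\}$ is a treatment indicator with $0<P(D=1)<1$. Assume that the two-way fixed effects model $$Y_i(t)=\beta(t)D_i+\lambda_i+\phi(t)+\varepsilon_i(t),\qquad t\in[-T_{pre},T_{post}],$$ holds with deterministic functions $\beta,\phi$, $\beta(0)=0$, individual effects $\lambda_i$ (possibly dependent on $D_i$), and integrable errors with $\mathbb{E}[\varepsilon_i(t)\mid D_i]=0$ for all $t$. Assume $\mathbb{E}[Y(t)^4]<\infty$ for all $t\in[-T_{pre},T_{post}]$ and $\mathbb{E}[D^4]<\infty$. *Estimators.* For a sample of size $n$ put $\dot D_i=D_i-\frac1n\sum_{j=1}^nD_j$, $\dot Y_i(t)=Y_i(t)-\frac1n\sum_{j=1}^nY_j(t)$ and $$\widehat\beta_n(t)=\Big(\frac1n\sum_{i=1}^n\dot D_i^2\Big)^{-1}\Big(\frac1n\sum_{i=1}^n\dot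 D_i\big(\dot Y_i(t)-\dot Y_i(0)\big)\Big).$$ With $T=T_{pre}+T_{post}+1$, and for integers $t,s\in\{-T_{pre},\dots,T_{post}\}$, let $Y_{it}=Y_i(t)$, $D_{its}=D_i\mathbf 1_{\{t=s\}}$ and, for a panel $x_{it}$, $$\ddot x_{it}=x_{it}-\frac1T\sum_{u=-T_{pre}}^{T_{post}}x_{iu}-\frac1n\sum_{j=1}^nx_{jt}+\frac1{nT}\sum_{j=1}^n\sum_{u=-T_{pre}}^{T_{post}}x_{ju}.$$ Let $\ddot D_{it}=(\ddot D_{its})_{s\ne0}\in\mathbb{R}^{T-1}$. The panel estimator is $$(\widehat\beta^{PD}_{n,t})_{t\neq0}=\Big(\frac1{nT}\sum_{i=1}^n\sum_{t=-T_{pre}}^{T_{post}}\ddot D_{it}\ddot D_{it}^\top\Big)^{-1}\Big(\frac1{nT}\sum_{i=1}^n\sum_{t=-T_{pre}}^{T_{post}}\ddot D_{it}\ddot Y_{it}\Big),\qquad \widehat\beta^{PD}_{n,0}=0.$$ (On the event, of vanishing probability, that all $D_i$, $i\le n$, coincide, the inverses do not exist and both estimators are set to $0$.) *Conclusion.* As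 $n\to\infty$, $$\sqrt n\,\big(\widehat\beta_n(t)-\beta(t)\big)\xrightarrow{d}\mathcal N\big(0,C_\beta(t,t)\big)\quad\text{for each }t\in[-T_{pre},T_{post}],$$ $$\sqrt n\,\big(\widehat\beta^{PD}_{n,t}-\beta(t)\big)\xrightarrow{d}\mathcal N\big(0,C_\beta(t,t)\big)\quad\text{for each }t\in\{-T_{pre},\dots,T_{post}\},$$ where, writing $\varepsilon$ for the error belonging to $(Y,D)$, $\dot D=D-\mathbb{E}[D]$ and $\dot\varepsilon(t)=\varepsilon(t)-\mathbb{E}[\varepsilon(t)]$, $$C_\beta(t,t)=\mathbb{E}\big[\dot D^2(\dot\varepsilon(t)-\dot\varepsilon(0))^2\big]\,\mathbb{E}[\dot D^2]^{-2}<\infty .$$ ($\mathcal N(0,0)$ denotes the point mass at $0$.) -/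

import Mathlib

open MeasureTheory ProbabilityTheory Filter
open scoped Matrix

noncomputable section

namespace EventStudy

/-- The continuous time span `[-T_pre, T_post]`. -/
abbrev TimeSpan (Tpre Tpost : ℕ) : Type := Set.Icc (-(Tpre : ℝ)) (Tpost : ℝ)

/-- The observation times `{-T_pre, …, 0, …, T_post}`. -/
abbrev PanelTime (Tpre Tpost : ℕ) : Type := Finset.Icc (-(Tpre : ℤ)) (Tpost : ℤ)

/-- The observation times other than the reference time `0`. -/
abbrev NonRefTime (Tpre Tpost : ℕ) : Type := {s : PanelTime Tpre Tpost // (s : ℤ) ≠ 0}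

/-- The reference time `0`, as a point of `[-T_pre, T_post]`. -/
def refTime (Tpre Tpost : ℕ) : TimeSpan Tpre Tpost :=
  ⟨0, by simp⟩

/-- An observation time, as a point of `[-T_pre, T_post]`. -/
def PanelTime.toSpan {Tpre Tpost : ℕ} (t : PanelTime Tpre Tpost) : TimeSpan Tpre Tpost :=
  ⟨((t : ℤ) : ℝ), by
    have h := Finset.mem_Icc.mp t.2
    exact ⟨by exact_mod_cast h.1, by exact_mod_cast h.2⟩⟩

/-! ### Estimators, as functions of the data of the first `n` units (labelled `0, …, n - 1`) -/

/-- Cross-sectional demeaning `x_i - n⁻¹ ∑_{j<n} x_j`. -/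
def demean (n : ℕ) (x : ℕ → ℝ) (i : ℕ) : ℝ :=
  x i - (n : ℝ)⁻¹ * ∑ j ∈ Finset.range n, x j

/-- The functional oracle estimator `β̂_n(t)`, for outcome curves `y i` and treatments `d i`. -/
def betaHat {Tpre Tpost : ℕ} (n : ℕ) (y : ℕ → TimeSpan Tpre Tpost → ℝ) (d : ℕ → ℝ)
    (t : TimeSpan Tpre Tpost) : ℝ :=
  ((n : ℝ)⁻¹ * ∑ i ∈ Finset.range n, demean n d i ^ 2)⁻¹ *
    ((n : ℝ)⁻¹ * ∑ i ∈ Finset.range n, demean n d i *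
      (demean n (fun j => y j t) i - demean n (fun j => y j (refTime Tpre Tpost)) i))

/-- The two-way within transformation of a panel `x_{it}`: subtract the unit means over time and
the time means over units, add the overall mean. -/
def twoWay {Tpre Tpost : ℕ} (n : ℕ) (x : ℕ → PanelTime Tpre Tpost → ℝ)
    (i : ℕ) (t : PanelTime Tpre Tpost) : ℝ :=
  x i t - ((Tpre + Tpost + 1 : ℕ) : ℝ)⁻¹ * ∑ s, x i s
    - (n : ℝ)⁻¹ * ∑ j ∈ Finset.range n, x j t
    + ((n : ℝ) * ((Tpre + Tpost + 1 : ℕ) : ℝ))⁻¹ * ∑ j ∈ Finset.range n, ∑ s, x j s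

/-- The vector, indexed by `s ≠ 0`, of the two-way transforms of the regressors
`D_{its} = D_i 1{t = s}`. -/
def panelRegressor {Tpre Tpost : ℕ} (n : ℕ) (d : ℕ → ℝ) (i : ℕ) (t : PanelTime Tpre Tpost) :
    NonRefTime Tpre Tpost → ℝ :=
  fun s => twoWay n (fun j u => d j * (if u = s.1 then 1 else 0)) i t

/-- `(nT)⁻¹ ∑_i ∑_t D̈_{it} D̈_{it}ᵀ`. -/
def panelGram (Tpre Tpost n : ℕ) (d : ℕ → ℝ) :
    Matrix (NonRefTime Tpre Tpost) (NonRefTime Tpre Tpost) ℝ :=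
  ((n : ℝ) * ((Tpre + Tpost + 1 : ℕ) : ℝ))⁻¹ •
    ∑ i ∈ Finset.range n, ∑ t : PanelTime Tpre Tpost,
      Matrix.vecMulVec (panelRegressor n d i t) (panelRegressor n d i t)

/-- `(nT)⁻¹ ∑_i ∑_t D̈_{it} Ÿ_{it}`. -/
def panelMoment {Tpre Tpost : ℕ} (n : ℕ) (y : ℕ → PanelTime Tpre Tpost → ℝ) (d : ℕ → ℝ) :
    NonRefTime Tpre Tpost → ℝ :=
  ((n : ℝ) * ((Tpre + Tpost + 1 : ℕ) : ℝ))⁻¹ •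
    ∑ i ∈ Finset.range n, ∑ t : PanelTime Tpre Tpost, twoWay n y i t • panelRegressor n d i t

/-- The two-way fixed effects panel estimator `β̂ᴾᴰ_{n,t}`, augmented by the value `0` at the
reference time `t = 0`. -/
def betaHatPD {Tpre Tpost : ℕ} (n : ℕ) (y : ℕ → PanelTime Tpre Tpost → ℝ) (d : ℕ → ℝ)
    (t : PanelTime Tpre Tpost) : ℝ :=
  if h : (t : ℤ) ≠ 0 then ((panelGram Tpre Tpost n d)⁻¹ *ᵥ panelMoment n y d) ⟨t, h⟩ else 0

/-! ### The sampling model -/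

/-- The pairs `(Y_i, D_i)`, each a random curve on `[-T_pre, T_post]` (with the σ-algebra
generated by the point evaluations) and a random number, are i.i.d. -/
structure IsIIDSample {Ω : Type*} [MeasurableSpace Ω] {Tpre Tpost : ℕ} (μ : Measure Ω)
    (Y : ℕ → TimeSpan Tpre Tpost → Ω → ℝ) (D : ℕ → Ω → ℝ) : Prop where
  measurable_Y : ∀ i t, Measurable (Y i t)
  measurable_D : ∀ i, Measurable (D i)
  indep : iIndepFun (fun i ω => ((fun t => Y i t ω), D i ω)) μ
  identDistrib : ∀ i, IdentDistrib (fun ω => ((fun t => Y i t ω), D i ω))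
    (fun ω => ((fun t => Y 0 t ω), D 0 ω)) μ μ

/-- The two-way fixed effects function-on-scalar regression model
`Y_i(t) = β(t) D_i + λ_i + φ(t) + ε_i(t)` with a binary treatment `D_i`, `β(0) = 0` and
`E[ε_i(t) | D_i] = 0`. -/
structure IsTWFEModel {Ω : Type*} [MeasurableSpace Ω] {Tpre Tpost : ℕ} (μ : Measure Ω)
    (Y : ℕ → TimeSpan Tpre Tpost → Ω → ℝ) (D : ℕ → Ω → ℝ) (β : TimeSpan Tpre Tpost → ℝ)
    (lam : ℕ → Ω → ℝ) (φ : TimeSpan Tpre Tpost → ℝ)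
    (ε : ℕ → TimeSpan Tpre Tpost → Ω → ℝ) : Prop where
  binary : ∀ i ω, D i ω = 0 ∨ D i ω = 1
  beta_ref : β (refTime Tpre Tpost) = 0
  outcome : ∀ i t, ∀ᵐ ω ∂μ, Y i t ω = β t * D i ω + lam i ω + φ t + ε i t ω
  integrable_error : ∀ i t, Integrable (ε i t) μ
  condExp_error : ∀ i t, μ[ε i t | MeasurableSpace.comap (D i) inferInstance] =ᵐ[μ] 0

/-- Population centring `X - E[X]`. -/
def center {Ω : Type*} [MeasurableSpace Ω] (μ : Measure Ω) (X : Ω → ℝ) (ω : Ω) : ℝ :=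
  X ω - ∫ ω', X ω' ∂μ

/-- The random variable `Ḋ² (ε̇(t) - ε̇(0))²`. -/
def scoreSq {Ω : Type*} [MeasurableSpace Ω] {Tpre Tpost : ℕ} (μ : Measure Ω)
    (D : Ω → ℝ) (ε : TimeSpan Tpre Tpost → Ω → ℝ) (t : TimeSpan Tpre Tpost) (ω : Ω) : ℝ :=
  center μ D ω ^ 2 * (center μ (ε t) ω - center μ (ε (refTime Tpre Tpost)) ω) ^ 2

/-- The asymptotic variance `C_β(t,t) = E[Ḋ² (ε̇(t) - ε̇(0))²] E[Ḋ²]⁻²`. -/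
def asympVar {Ω : Type*} [MeasurableSpace Ω] {Tpre Tpost : ℕ} (μ : Measure Ω)
    (D : Ω → ℝ) (ε : TimeSpan Tpre Tpost → Ω → ℝ) (t : TimeSpan Tpre Tpost) : ℝ :=
  (∫ ω, scoreSq μ D ε t ω ∂μ) * ((∫ ω, center μ D ω ^ 2 ∂μ) ^ 2)⁻¹

end EventStudy

end

/-! Differencing against time `0` removes `lam i`, so `betaHat` is the least squares slope of Y_i(t)
- Y_i(0) = β(t) D_i + c + U_i on D_i, with U_i = ε_i(t) - ε_i(0) almost surely. With S_n the sample
variance of D and m = E[D], once S_n ≠ 0 the scaled error √n (slope - β(t)) equals S_n⁻¹ (n^{-1/2} ∑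
(D_i - m) U_i - (mean of D - m) n^{-1/2} ∑ U_i). The first sum obeys the central limit theorem,
because E[ε | D] = 0 makes its summands centred; the second term is o_P(1) O_P(1); and S_n → Var D >
0 by the strong law. Slutsky's lemma gives the limit (`tendstoInDistribution_slope`).

The panel estimator needs no limit theory of its own: its regressors factor into a unit part and a
time part, its Gram matrix inverts explicitly, and it equals `betaHat` for every sample
(`betaHatPD_eq`). -/

open scoped Topology

/-! ### Slutsky-type lemmas -/

namespace MeasureTheory

variable {Ω Ω' : Type*} {mΩ : MeasurableSpace Ω} {mΩ' : MeasurableSpace Ω'}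
  {μ : Measure Ω} [IsProbabilityMeasure μ] {P : Measure Ω'} [IsProbabilityMeasure P]

/-- Convergence in distribution to a constant implies convergence in probability. -/
lemma TendstoInDistribution.tendstoInMeasure_const {ι : Type*} {l : Filter ι}
    {X : ι → Ω → ℝ} {c : ℝ}
    (h : TendstoInDistribution X l (fun _ : Ω' => c) (fun _ => μ) P) :
    TendstoInMeasure μ X l (fun _ => c) := by
  rw [tendstoInMeasure_iff_measureReal_dist]
  intro δ hδ
  have hclosed : IsClosed {x : ℝ | δ ≤ dist x c} := isClosed_le (by fun_prop) (by fun_prop)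
  -- Since δ > 0 the closed set omits c, so the point mass at c does not charge its frontier and the
  -- portmanteau theorem applies.
  have hfront : (P.map fun _ : Ω' => c) (frontier {x : ℝ | δ ≤ dist x c}) = 0 := by
    refine measure_mono_null hclosed.frontier_subset ?_
    rw [Measure.map_apply (by fun_prop) hclosed.measurableSet]
    simp [hδ.not_ge]
  have key := ProbabilityMeasure.tendsto_measure_of_null_frontier_of_tendsto' h.tendsto hfront
  simp only [ProbabilityMeasure.coe_mk] at key
  rw [Measure.map_apply (by fun_prop) hclosed.measurableSet] at key
  have key' := (ENNReal.tendsto_toReal (by simp)).comp key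
  convert! key' using 2
  · simp only [Function.comp_apply]
    rw [Measure.map_apply_of_aemeasurable (h.forall_aemeasurable _) hclosed.measurableSet]
    rfl
  · simp [hδ.not_ge]

/-- The product of a sequence converging in distribution and a sequence converging to `0` in
probability converges to `0` in probability. -/
lemma TendstoInDistribution.mul_tendstoInMeasure_zero {ι : Type*} {l : Filter ι}
    [l.IsCountablyGenerated] {X V : ι → Ω → ℝ} {Z : Ω' → ℝ}
    (h : TendstoInDistribution X l Z (fun _ => μ) P)
    (hV : TendstoInMeasure μ V l (fun _ => 0)) (hVm : ∀ i, AEMeasurable (V i) μ) :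
    TendstoInMeasure μ (fun i ω => V i ω * X i ω) l (fun _ => 0) := by
  have := h.continuous_comp_prodMk_of_tendstoInMeasure_const
    (g := fun x : ℝ × ℝ => x.2 * x.1) (by fun_prop) hV hVm
  simp only [zero_mul] at this
  exact this.tendstoInMeasure_const

end MeasureTheory

namespace EventStudy

/-! ### Algebra of the least squares slope -/

/-- The cross-sectional second moment `n⁻¹ ∑ ẋ_i ẏ_i`. -/
noncomputable def sampleCov (n : ℕ) (x y : ℕ → ℝ) : ℝ :=
  (n : ℝ)⁻¹ * ∑ i ∈ Finset.range n, demean n x i * demean n y i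

lemma demean_sub (n : ℕ) (x y : ℕ → ℝ) (i : ℕ) :
    demean n (fun j => x j - y j) i = demean n x i - demean n y i := by
  simp only [demean, Finset.sum_sub_distrib]
  ring

lemma sampleCov_sub_right (n : ℕ) (d x y : ℕ → ℝ) :
    sampleCov n d (fun j => x j - y j) = sampleCov n d x - sampleCov n d y := by
  simp only [sampleCov, demean_sub, mul_sub, Finset.sum_sub_distrib]

/-- The sample covariance, computed from observations centred at an arbitrary `m`. -/
lemma sampleCov_eq_centered (n : ℕ) (x y : ℕ → ℝ) (m : ℝ) :
    sampleCov n x y = (n : ℝ)⁻¹ * ∑ i ∈ Finset.range n, (x i - m) * y i -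
      ((n : ℝ)⁻¹ * ∑ i ∈ Finset.range n, x i - m) * ((n : ℝ)⁻¹ * ∑ i ∈ Finset.range n, y i) := by
  rcases Nat.eq_zero_or_pos n with rfl | hn
  · simp [sampleCov]
  have hn' : (n : ℝ) ≠ 0 := by positivity
  simp only [sampleCov, demean]
  generalize hx : (n : ℝ)⁻¹ * ∑ j ∈ Finset.range n, x j = a
  generalize hy : (n : ℝ)⁻¹ * ∑ j ∈ Finset.range n, y j = b
  have hx' : ∑ j ∈ Finset.range n, x j = n * a := by rw [← hx]; field_simp
  have hy' : ∑ j ∈ Finset.range n, y j = n * b := by rw [← hy]; field_simp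
  have h1 : ∑ i ∈ Finset.range n, (x i - a) * (y i - b)
      = ∑ i ∈ Finset.range n, x i * y i - n * a * b := by
    simp only [sub_mul, mul_sub, Finset.sum_sub_distrib, ← Finset.sum_mul, ← Finset.mul_sum,
      hx', hy', Finset.sum_const, Finset.card_range, nsmul_eq_mul]
    ring
  have h2 : ∑ i ∈ Finset.range n, (x i - m) * y i
      = ∑ i ∈ Finset.range n, x i * y i - m * (n * b) := by
    simp only [sub_mul, Finset.sum_sub_distrib, ← Finset.mul_sum, hy']
  rw [h1, h2]
  field_simp
  ring

/-- The sample covariance with a linear model `w = b x + c + u`. -/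
lemma sampleCov_linear (n : ℕ) (x u : ℕ → ℝ) (b c : ℝ) :
    sampleCov n x (fun i => b * x i + c + u i) = b * sampleCov n x x + sampleCov n x u := by
  rcases Nat.eq_zero_or_pos n with rfl | hn
  · simp [sampleCov]
  have hn' : (n : ℝ) ≠ 0 := by positivity
  have : ∀ i, demean n (fun i => b * x i + c + u i) i = b * demean n x i + demean n u i := by
    intro i
    simp only [demean, Finset.sum_add_distrib, ← Finset.mul_sum, Finset.sum_const,
      Finset.card_range, nsmul_eq_mul]
    field_simp
    ring
  simp only [sampleCov, this, mul_add, Finset.sum_add_distrib, Finset.mul_sum]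
  congr 1
  exact Finset.sum_congr rfl fun i _ => by ring

lemma betaHat_eq {Tpre Tpost : ℕ} (n : ℕ) (y : ℕ → TimeSpan Tpre Tpost → ℝ) (d : ℕ → ℝ)
    (t : TimeSpan Tpre Tpost) :
    betaHat n y d t = (sampleCov n d d)⁻¹ *
      sampleCov n d (fun j => y j t - y j (refTime Tpre Tpost)) := by
  simp only [betaHat, sampleCov, demean_sub, pow_two]

/-! ### The panel estimator coincides with the functional one -/

section Panel

variable {Tpre Tpost : ℕ}

lemma card_panelTime : Fintype.card (PanelTime Tpre Tpost) = Tpre + Tpost + 1 := by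
  simp only [Fintype.card_coe, Int.card_Icc]
  omega

/-- Two-way demeaning is cross-sectional demeaning followed by demeaning over time. -/
lemma twoWay_eq (n : ℕ) (x : ℕ → PanelTime Tpre Tpost → ℝ) (i : ℕ) (t : PanelTime Tpre Tpost) :
    twoWay n x i t = demean n (fun j => x j t) i -
      ((Tpre + Tpost + 1 : ℕ) : ℝ)⁻¹ * ∑ s, demean n (fun j => x j s) i := by
  simp only [twoWay, demean, Finset.sum_sub_distrib, ← Finset.mul_sum]
  rw [Finset.sum_comm (s := Finset.univ), mul_inv]
  ring

lemma sum_twoWay (n : ℕ) (x : ℕ → PanelTime Tpre Tpost → ℝ) (i : ℕ) :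
    ∑ t, twoWay n x i t = 0 := by
  have hT : ((Tpre + Tpost + 1 : ℕ) : ℝ) ≠ 0 := by positivity
  simp only [twoWay_eq, Finset.sum_sub_distrib, Finset.sum_const, Finset.card_univ, card_panelTime,
    nsmul_eq_mul]
  rw [mul_inv_cancel_left₀ hT, sub_self]

/-- A regressor is a function of the unit times a function of time, so two-way demeaning acts on
each factor separately; the indicator of one date has time mean 1/T. -/
lemma panelRegressor_eq (n : ℕ) (d : ℕ → ℝ) (i : ℕ) (t : PanelTime Tpre Tpost)
    (s : NonRefTime Tpre Tpost) :
    panelRegressor n d i t s = demean n d i *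
      ((if t = s.1 then 1 else 0) - ((Tpre + Tpost + 1 : ℕ) : ℝ)⁻¹) := by
  have h : ∀ u : PanelTime Tpre Tpost, demean n (fun j => d j * (if u = s.1 then 1 else 0)) i
      = demean n d i * (if u = s.1 then 1 else 0) := by
    intro u
    simp only [demean, ← Finset.sum_mul]
    ring
  simp only [panelRegressor, twoWay_eq, h, ← Finset.mul_sum, Finset.sum_ite_eq',
    Finset.mem_univ, if_true]
  ring

lemma panelGram_apply (n : ℕ) (d : ℕ → ℝ) (s s' : NonRefTime Tpre Tpost) :
    panelGram Tpre Tpost n d s s' = sampleCov n d d * ((Tpre + Tpost + 1 : ℕ) : ℝ)⁻¹ *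
      ((if s = s' then 1 else 0) - ((Tpre + Tpost + 1 : ℕ) : ℝ)⁻¹) := by
  have hT : ((Tpre + Tpost + 1 : ℕ) : ℝ) ≠ 0 := by positivity
  have hsum : ∑ t : PanelTime Tpre Tpost,
      ((if t = s.1 then (1 : ℝ) else 0) - ((Tpre + Tpost + 1 : ℕ) : ℝ)⁻¹) *
      ((if t = s'.1 then 1 else 0) - ((Tpre + Tpost + 1 : ℕ) : ℝ)⁻¹)
      = (if s = s' then 1 else 0) - ((Tpre + Tpost + 1 : ℕ) : ℝ)⁻¹ := by
    simp only [sub_mul, mul_sub, Finset.sum_sub_distrib, ← Finset.sum_mul, ← Finset.mul_sum,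
      Finset.sum_ite_eq', Finset.mem_univ, if_true, ite_mul, one_mul, zero_mul,
      Finset.sum_const, Finset.card_univ, card_panelTime, nsmul_eq_mul]
    simp only [← Subtype.ext_iff]
    rw [mul_inv_cancel₀ hT]
    ring
  simp only [panelGram, Matrix.smul_apply, Matrix.sum_apply, Matrix.vecMulVec_apply,
    panelRegressor_eq, smul_eq_mul]
  have : ∀ i, ∑ t : PanelTime Tpre Tpost,
      demean n d i * ((if t = s.1 then (1 : ℝ) else 0) - ((Tpre + Tpost + 1 : ℕ) : ℝ)⁻¹) *
      (demean n d i * ((if t = s'.1 then 1 else 0) - ((Tpre + Tpost + 1 : ℕ) : ℝ)⁻¹))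
      = demean n d i * demean n d i *
        ((if s = s' then 1 else 0) - ((Tpre + Tpost + 1 : ℕ) : ℝ)⁻¹) := by
    intro i
    rw [← hsum, Finset.mul_sum]
    exact Finset.sum_congr rfl fun t _ => by ring
  simp only [this, ← Finset.sum_mul, sampleCov, mul_inv]
  ring

/-- Two-way transforms sum to zero over time (`sum_twoWay`), so the constant 1/T in the regressor
contributes nothing and only date s survives. -/
lemma panelMoment_apply (n : ℕ) (y : ℕ → PanelTime Tpre Tpost → ℝ) (d : ℕ → ℝ)
    (s : NonRefTime Tpre Tpost) :
    panelMoment n y d s = ((Tpre + Tpost + 1 : ℕ) : ℝ)⁻¹ *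
      (sampleCov n d (fun j => y j s.1) -
        ((Tpre + Tpost + 1 : ℕ) : ℝ)⁻¹ * ∑ u, sampleCov n d (fun j => y j u)) := by
  have h : ∀ i, ∑ t : PanelTime Tpre Tpost, twoWay n y i t *
      (demean n d i * ((if t = s.1 then (1 : ℝ) else 0) - ((Tpre + Tpost + 1 : ℕ) : ℝ)⁻¹))
      = demean n d i * twoWay n y i s.1 := by
    intro i
    simp only [mul_sub, Finset.sum_sub_distrib, ← Finset.sum_mul, sum_twoWay, mul_ite, mul_one,
      mul_zero, Finset.sum_ite_eq', Finset.mem_univ, if_true]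
    ring
  simp only [panelMoment, Pi.smul_apply, Finset.sum_apply, smul_eq_mul, panelRegressor_eq, h]
  simp only [twoWay_eq, mul_sub, Finset.sum_sub_distrib, sampleCov, mul_inv]
  have hs : ∑ i ∈ Finset.range n, demean n d i * (((Tpre + Tpost + 1 : ℕ) : ℝ)⁻¹ *
      ∑ u, demean n (fun j => y j u) i) = ((Tpre + Tpost + 1 : ℕ) : ℝ)⁻¹ *
      ∑ u, ∑ i ∈ Finset.range n, demean n d i * demean n (fun j => y j u) i := by
    rw [Finset.sum_comm, Finset.mul_sum]
    refine Finset.sum_congr rfl fun i _ => ?_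
    rw [← Finset.mul_sum]
    ring
  rw [hs, ← Finset.mul_sum]
  ring

/-- The reference time `0`, as an observation time. -/
def panelRef (Tpre Tpost : ℕ) : PanelTime Tpre Tpost := ⟨0, by simp⟩

lemma toSpan_panelRef : (panelRef Tpre Tpost).toSpan = refTime Tpre Tpost := by
  simp [PanelTime.toSpan, panelRef, refTime]

lemma sum_nonRefTime (f : PanelTime Tpre Tpost → ℝ) :
    ∑ s : NonRefTime Tpre Tpost, f s.1 = ∑ s, f s - f (panelRef Tpre Tpost) := by
  rw [← Finset.sum_erase_eq_sub (Finset.mem_univ _)]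
  symm
  refine Finset.sum_subtype _ (fun x => ?_) f
  simp [panelRef, Subtype.ext_iff]

lemma card_nonRefTime : (Fintype.card (NonRefTime Tpre Tpost) : ℝ) = (Tpre + Tpost + 1 : ℕ) - 1 := by
  have := sum_nonRefTime (Tpre := Tpre) (Tpost := Tpost) (fun _ => 1)
  simpa only [Finset.sum_const, Finset.card_univ, nsmul_eq_mul, mul_one, card_panelTime] using this

/-- The panel estimator is the functional estimator at the observation times. -/
lemma betaHatPD_eq (n : ℕ) (y : ℕ → TimeSpan Tpre Tpost → ℝ) (d : ℕ → ℝ)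
    (t : PanelTime Tpre Tpost) :
    betaHatPD n (fun i s => y i s.toSpan) d t = betaHat n y d t.toSpan := by
  have hT : ((Tpre + Tpost + 1 : ℕ) : ℝ) ≠ 0 := by positivity
  rw [betaHatPD]
  split_ifs with h
  swap
  · have : t = panelRef Tpre Tpost := Subtype.ext (not_not.mp h)
    simp [this, toSpan_panelRef, betaHat]
  -- Without treatment variation (including n = 0) the Gram matrix vanishes; the inverse of zero is
  -- zero, so both estimators are `0`.
  by_cases hS : sampleCov n d d = 0
  · have hG : panelGram Tpre Tpost n d = 0 := by
      ext s s'
      simp [panelGram_apply, hS]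
    simp [hG, betaHat_eq, hS]
  set m : PanelTime Tpre Tpost → ℝ := fun u => sampleCov n d (fun j => y j u.toSpan)
  -- With J the all-ones matrix of size T - 1, J² = (T - 1) J, hence (I - J/T)(I + J) = I.
  let B : Matrix (NonRefTime Tpre Tpost) (NonRefTime Tpre Tpost) ℝ :=
    Matrix.of fun s s' =>
      (sampleCov n d d)⁻¹ * ((Tpre + Tpost + 1 : ℕ) : ℝ) * ((if s = s' then 1 else 0) + 1)
  have hB : panelGram Tpre Tpost n d * B = 1 := by
    ext s s'
    simp only [Matrix.mul_apply, panelGram_apply, B, Matrix.of_apply, Matrix.one_apply]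
    have : ∀ r : NonRefTime Tpre Tpost,
        sampleCov n d d * ((Tpre + Tpost + 1 : ℕ) : ℝ)⁻¹ *
          ((if s = r then (1 : ℝ) else 0) - ((Tpre + Tpost + 1 : ℕ) : ℝ)⁻¹) *
        ((sampleCov n d d)⁻¹ * ((Tpre + Tpost + 1 : ℕ) : ℝ) * ((if r = s' then 1 else 0) + 1)) =
        ((if s = r then (1 : ℝ) else 0) - ((Tpre + Tpost + 1 : ℕ) : ℝ)⁻¹) *
          ((if r = s' then 1 else 0) + 1) := by
      intro r
      field_simp
    simp only [this]
    simp only [sub_mul, mul_add, mul_one, Finset.sum_sub_distrib, Finset.sum_add_distrib,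
      ← Finset.mul_sum, ite_mul, one_mul, zero_mul, Finset.sum_ite_eq, Finset.sum_ite_eq',
      Finset.mem_univ, if_true, Finset.sum_const, Finset.card_univ, nsmul_eq_mul, card_nonRefTime]
    field_simp
    ring
  rw [Matrix.inv_eq_right_inv hB]
  simp only [Matrix.mulVec, dotProduct, B, Matrix.of_apply, panelMoment_apply, add_mul, mul_add, mul_one]
  rw [betaHat_eq, sampleCov_sub_right, ← toSpan_panelRef]
  -- Deviations of m from its time mean sum to zero over all dates, so over s ≠ 0 they sum to minus
  -- the deviation at `0`. Row t of I + J thus yields m t - m 0.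
  change ∑ x : NonRefTime Tpre Tpost, ((sampleCov n d d)⁻¹ * ((Tpre + Tpost + 1 : ℕ) : ℝ) *
      (if (⟨t, h⟩ : NonRefTime Tpre Tpost) = x then 1 else 0) *
      (((Tpre + Tpost + 1 : ℕ) : ℝ)⁻¹ * (m x.1 - ((Tpre + Tpost + 1 : ℕ) : ℝ)⁻¹ * ∑ u, m u)) +
      (sampleCov n d d)⁻¹ * ((Tpre + Tpost + 1 : ℕ) : ℝ) *
      (((Tpre + Tpost + 1 : ℕ) : ℝ)⁻¹ * (m x.1 - ((Tpre + Tpost + 1 : ℕ) : ℝ)⁻¹ * ∑ u, m u))) =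
    (sampleCov n d d)⁻¹ * (m t - m (panelRef Tpre Tpost))
  simp only [Finset.sum_add_distrib, mul_ite, mul_one, mul_zero, ite_mul, zero_mul,
    Finset.sum_ite_eq, Finset.mem_univ, if_true, ← Finset.mul_sum, Finset.sum_sub_distrib,
    sum_nonRefTime, Finset.sum_const, Finset.card_univ, nsmul_eq_mul, card_nonRefTime]
  field_simp
  ring

end Panel

end EventStudy

namespace EventStudy

/-! ### Asymptotics of the least squares slope -/

section Slope

variable {Ω : Type*} [MeasurableSpace Ω] {μ : Measure Ω}

lemma aemeasurable_sampleCov {X W : ℕ → Ω → ℝ} (hX : ∀ i, AEMeasurable (X i) μ)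
    (hW : ∀ i, AEMeasurable (W i) μ) (n : ℕ) :
    AEMeasurable (fun ω => sampleCov n (fun i => X i ω) (fun i => W i ω)) μ := by
  unfold sampleCov demean
  fun_prop

/-- The strong law for the sample mean of a function of i.i.d. observations. -/
lemma ae_tendsto_sampleMean_comp {E : Type*} [MeasurableSpace E] {Z : ℕ → Ω → E}
    (hindep : iIndepFun Z μ) (hident : ∀ i, IdentDistrib (Z i) (Z 0) μ μ)
    {g : E → ℝ} (hg : Measurable g) (hint : Integrable (fun ω => g (Z 0 ω)) μ) :
    ∀ᵐ ω ∂μ, Tendsto (fun n : ℕ => (n : ℝ)⁻¹ * ∑ i ∈ Finset.range n, g (Z i ω)) atTop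
      (𝓝 (∫ ω, g (Z 0 ω) ∂μ)) := by
  have h := strong_law_ae_real (fun i ω => g (Z i ω)) hint
    (fun i j hij => (hindep.indepFun hij).comp hg hg) (fun i => (hident i).comp hg)
  filter_upwards [h] with ω hω
  simpa only [div_eq_inv_mul] using hω

/-- The central limit theorem for a centred function of i.i.d. observations. -/
lemma tendstoInDistribution_sum_comp [IsProbabilityMeasure μ] {Ω' : Type*} [MeasurableSpace Ω']
    {P : Measure Ω'} [IsProbabilityMeasure P] {G : Ω' → ℝ}
    {E : Type*} [MeasurableSpace E] {Z : ℕ → Ω → E}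
    (hindep : iIndepFun Z μ) (hident : ∀ i, IdentDistrib (Z i) (Z 0) μ μ)
    {g : E → ℝ} (hg : Measurable g) (hL2 : MemLp (fun ω => g (Z 0 ω)) 2 μ)
    (hmean : ∫ ω, g (Z 0 ω) ∂μ = 0)
    (hG : HasLaw G (gaussianReal 0 (∫ ω, g (Z 0 ω) ^ 2 ∂μ).toNNReal) P) :
    TendstoInDistribution (fun (n : ℕ) ω => (√n)⁻¹ * ∑ i ∈ Finset.range n, g (Z i ω)) atTop G
      (fun _ => μ) P := by
  have hvar : Var[fun ω => g (Z 0 ω); μ] = ∫ ω, g (Z 0 ω) ^ 2 ∂μ :=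
    variance_of_integral_eq_zero hL2.1.aemeasurable hmean
  have h := tendstoInDistribution_inv_sqrt_mul_sum_sub (P := μ) (P' := P) (Y := G)
    (X := fun i ω => g (Z i ω)) (by rw [hvar]; exact hG) hL2 (hindep.comp (fun _ => g) fun _ => hg)
    (fun i => (hident i).comp hg)
  simpa only [hmean, mul_zero, sub_zero] using h

/-- **Asymptotic normality of the least squares slope** in a regression `W = b X + c + U` on an
i.i.d. sample with centred errors `U` uncorrelated with the regressor `X`, without assuming
homoskedasticity. -/
theorem tendstoInDistribution_slope [IsProbabilityMeasure μ] {X U : ℕ → Ω → ℝ}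
    (hindep : iIndepFun (fun i ω => (X i ω, U i ω)) μ)
    (hident : ∀ i, IdentDistrib (fun ω => (X i ω, U i ω)) (fun ω => (X 0 ω, U 0 ω)) μ μ)
    (hX : MemLp (X 0) 2 μ) (hU : MemLp (U 0) 2 μ)
    (hXU : MemLp (fun ω => center μ (X 0) ω * U 0 ω) 2 μ)
    (hU_mean : ∫ ω, U 0 ω ∂μ = 0) (hXU_mean : ∫ ω, center μ (X 0) ω * U 0 ω ∂μ = 0)
    (hvar : ∫ ω, center μ (X 0) ω ^ 2 ∂μ ≠ 0) (b c : ℝ) :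
    TendstoInDistribution
      (fun (n : ℕ) ω => √n * ((sampleCov n (fun i => X i ω) (fun i => X i ω))⁻¹ *
        sampleCov n (fun i => X i ω) (fun i => b * X i ω + c + U i ω) - b))
      atTop id (fun _ => μ)
      (gaussianReal 0 ((∫ ω, (center μ (X 0) ω * U 0 ω) ^ 2 ∂μ) *
        ((∫ ω, center μ (X 0) ω ^ 2 ∂μ) ^ 2)⁻¹).toNNReal) := by
  set m : ℝ := ∫ ω, X 0 ω ∂μ with hm
  set q : ℝ := ∫ ω, center μ (X 0) ω ^ 2 ∂μ with hq
  set s : ℝ := ∫ ω, (center μ (X 0) ω * U 0 ω) ^ 2 ∂μ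
  set P := gaussianReal 0 (s * (q ^ 2)⁻¹).toNNReal
  have hs0 : 0 ≤ s := integral_nonneg fun ω => sq_nonneg _
  have hXm : ∀ i, AEMeasurable (X i) μ := fun i => (hident i).aemeasurable_fst.fst
  have hUm : ∀ i, AEMeasurable (U i) μ := fun i => (hident i).aemeasurable_fst.snd
  have hX1 : Integrable (X 0) μ := hX.integrable one_le_two
  have hV : ∀ᵐ ω ∂μ, Tendsto (fun n : ℕ => (n : ℝ)⁻¹ * ∑ i ∈ Finset.range n, X i ω - m) atTop
      (𝓝 0) := by
    filter_upwards [ae_tendsto_sampleMean_comp hindep hident measurable_fst hX1] with ω hω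
    simpa [hm] using hω.sub_const m
  have hVm : ∀ n : ℕ, AEMeasurable
      (fun ω => (n : ℝ)⁻¹ * ∑ i ∈ Finset.range n, X i ω - m) μ := fun n => by fun_prop
  have hcX : Integrable (fun ω => (X 0 ω - m) * X 0 ω) μ :=
    (hX.sub (memLp_const m)).integrable_mul hX
  -- X - m is orthogonal to constants; this matches the one-sided centring of
  -- `sampleCov_eq_centered`.
  have hq' : ∫ ω, (X 0 ω - m) * X 0 ω ∂μ = q := by
    have h0 : ∫ ω, m * (X 0 ω - m) ∂μ = 0 := by
      rw [integral_const_mul, integral_sub hX1 (integrable_const m)]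
      simp [hm]
    have h1 : ∀ ω, center μ (X 0) ω ^ 2 = (X 0 ω - m) * X 0 ω - m * (X 0 ω - m) := by
      intro ω
      simp only [center, ← hm]
      ring
    rw [hq]
    simp only [h1]
    have h2 : Integrable (fun ω => m * (X 0 ω - m)) μ := (hX1.sub (integrable_const m)).const_mul m
    rw [integral_sub hcX h2, h0, sub_zero]
  have hS : ∀ᵐ ω ∂μ, Tendsto (fun n : ℕ => sampleCov n (fun i => X i ω) (fun i => X i ω)) atTop
      (𝓝 q) := by
    filter_upwards [hV, ae_tendsto_sampleMean_comp hindep hident measurable_fst hX1,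
      ae_tendsto_sampleMean_comp hindep hident (g := fun z => (z.1 - m) * z.1) (by fun_prop) hcX]
      with ω h1 h2 h3
    simp only [sampleCov_eq_centered _ _ _ m]
    simpa [hq'] using h3.sub (h1.mul h2)
  have hSm := aemeasurable_sampleCov hXm hXm
  -- The limit is written as q times a variable of law P, so that division by S_n → q leaves exactly
  -- `id` under P.
  have hA : TendstoInDistribution
      (fun (n : ℕ) ω => (√n)⁻¹ * ∑ i ∈ Finset.range n, (X i ω - m) * U i ω) atTop
      (fun x => q * x) (fun _ => μ) P := by
    refine tendstoInDistribution_sum_comp hindep hident (g := fun z => (z.1 - m) * z.2)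
      (by fun_prop) hXU hXU_mean ?_
    have hlaw := gaussianReal_const_mul (X := id) (P := P) HasLaw.id q
    convert! hlaw using 2
    · simp
    · change s.toNNReal = _
      ext
      simp only [NNReal.coe_mul, NNReal.coe_mk]
      rw [Real.coe_toNNReal _ hs0, Real.coe_toNNReal _ (by positivity)]
      field_simp
  have hB : TendstoInDistribution
      (fun (n : ℕ) ω => (√n)⁻¹ * ∑ i ∈ Finset.range n, U i ω) atTop id (fun _ => μ)
      (gaussianReal 0 (∫ ω, U 0 ω ^ 2 ∂μ).toNNReal) :=
    tendstoInDistribution_sum_comp hindep hident (g := fun z => z.2) measurable_snd hU hU_mean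
      HasLaw.id
  -- The effect of centring X at its sample mean instead of m: a vanishing factor times a sequence
  -- converging in distribution.
  have hVB := hB.mul_tendstoInMeasure_zero
    (tendstoInMeasure_of_tendsto_ae (fun n => (hVm n).aestronglyMeasurable) hV) hVm
  have hAVB := hA.continuous_comp_prodMk_of_tendstoInMeasure_const
    (g := fun z : ℝ × ℝ => z.1 - z.2) (by fun_prop) hVB (fun n => by fun_prop)
  have hSinv : TendstoInMeasure μ
      (fun n ω => (sampleCov n (fun i => X i ω) (fun i => X i ω))⁻¹) atTop (fun _ => q⁻¹) := by
    refine tendstoInMeasure_of_tendsto_ae (fun n => (hSm n).inv.aestronglyMeasurable) ?_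
    filter_upwards [hS] with ω hω using hω.inv₀ hvar
  have hlin := hAVB.continuous_comp_prodMk_of_tendstoInMeasure_const
    (g := fun z : ℝ × ℝ => z.2 * z.1) (by fun_prop) hSinv (fun n => (hSm n).inv)
  have hlim : (fun x : ℝ => q⁻¹ * (q * x - 0)) = id := by
    ext x
    simp [hvar]
  simp only [hlim] at hlin
  have hW : ∀ i, AEMeasurable (fun ω => b * X i ω + c + U i ω) μ := fun i => by
    have := hXm i
    have := hUm i
    fun_prop
  have hest : ∀ n : ℕ, AEMeasurable (fun ω =>
      √n * ((sampleCov n (fun i => X i ω) (fun i => X i ω))⁻¹ *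
        sampleCov n (fun i => X i ω) (fun i => b * X i ω + c + U i ω) - b)) μ := fun n =>
    (((hSm n).inv.mul (aemeasurable_sampleCov hXm hW n)).sub_const b).const_mul _
  -- The linearisation is exact whenever n > 0 and S_n ≠ 0; as S_n → q ≠ 0, the difference is almost
  -- surely eventually zero.
  refine tendstoInDistribution_of_tendstoInMeasure_sub _ _ hlin ?_ hest
  refine tendstoInMeasure_of_tendsto_ae
    (fun n => ((hest n).sub (hlin.forall_aemeasurable n)).aestronglyMeasurable) ?_
  filter_upwards [hS] with ω hω
  refine tendsto_const_nhds.congr' ?_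
  filter_upwards [hω.eventually_ne hvar, eventually_gt_atTop 0] with n hn hpos
  have hsq : √(n : ℝ) * (n : ℝ)⁻¹ = (√(n : ℝ))⁻¹ := by
    have : (0 : ℝ) < n := by exact_mod_cast hpos
    rw [← div_eq_mul_inv, Real.sqrt_div_self]
  simp only [Pi.sub_apply, Pi.zero_apply, sampleCov_linear]
  rw [mul_add, mul_comm b, inv_mul_cancel_left₀ hn, add_sub_cancel_left,
    sampleCov_eq_centered n _ (fun i => U i ω) m, ← hsq]
  ring

end Slope

end EventStudy

namespace EventStudy

/-! ### The two-way fixed effects model -/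

section Model

variable {Ω : Type*} [MeasurableSpace Ω] {μ : Measure Ω}

lemma memLp_two_of_integrable_pow_four [IsProbabilityMeasure μ] {f : Ω → ℝ} (hf : AEStronglyMeasurable f μ)
    (h : Integrable (fun ω => f ω ^ 4) μ) : MemLp f 2 μ := by
  rw [memLp_two_iff_integrable_sq hf]
  refine ((integrable_const (1 : ℝ)).add h).mono' (hf.pow 2) (ae_of_all _ fun ω => ?_)
  rw [Real.norm_of_nonneg (sq_nonneg _)]
  simp only [Pi.add_apply]
  nlinarith [sq_nonneg (f ω ^ 2 - 1), sq_nonneg (f ω ^ 2)]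

/-- Zero variance would make D almost surely constant: the constant 1 contradicts P(D = 1) < 1, any
other contradicts P(D = 1) > 0. -/
lemma integral_center_sq_ne_zero [IsProbabilityMeasure μ] {D : Ω → ℝ} (hD : MemLp D 2 μ)
    (hoverlap : 0 < μ {ω | D ω = 1} ∧ μ {ω | D ω = 1} < 1) :
    ∫ ω, center μ D ω ^ 2 ∂μ ≠ 0 := by
  intro h0
  have hint : Integrable (fun ω => center μ D ω ^ 2) μ := (hD.sub (memLp_const _)).integrable_sq
  rw [integral_eq_zero_iff_of_nonneg (fun ω => sq_nonneg _) hint] at h0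
  have hae : ∀ᵐ ω ∂μ, D ω = ∫ ω', D ω' ∂μ := by
    filter_upwards [h0] with ω hω
    simpa [center, sub_eq_zero] using hω
  by_cases hm : ∫ ω', D ω' ∂μ = 1
  · refine hoverlap.2.ne ((prob_compl_eq_zero_iff₀ ?_).mp ?_)
    · exact hD.1.nullMeasurableSet_eq_fun aestronglyMeasurable_const
    · refine mem_ae_iff.mp ?_
      filter_upwards [hae] with ω hω using hω.trans hm
  · refine hoverlap.1.ne' (measure_eq_zero_iff_ae_notMem.mpr ?_)
    filter_upwards [hae] with ω hω h1
    exact hm (hω.symm.trans h1)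

variable {Tpre Tpost : ℕ} {Y : ℕ → TimeSpan Tpre Tpost → Ω → ℝ} {D : ℕ → Ω → ℝ}
  {β : TimeSpan Tpre Tpost → ℝ} {lam : ℕ → Ω → ℝ} {φ : TimeSpan Tpre Tpost → ℝ}
  {ε : ℕ → TimeSpan Tpre Tpost → Ω → ℝ}

namespace IsTWFEModel

lemma abs_treatment_le (h : IsTWFEModel μ Y D β lam φ ε) (i : ℕ) (ω : Ω) : |D i ω| ≤ 1 := by
  rcases h.binary i ω with h | h <;> simp [h]

/-- The error of the model for the increments `Y(t) - Y(0)`. -/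
lemma increment_error (h : IsTWFEModel μ Y D β lam φ ε) (i : ℕ) (t : TimeSpan Tpre Tpost) :
    ∀ᵐ ω ∂μ, Y i t ω - Y i (refTime Tpre Tpost) ω - β t * D i ω - (φ t - φ (refTime Tpre Tpost)) =
      ε i t ω - ε i (refTime Tpre Tpost) ω := by
  filter_upwards [h.outcome i t, h.outcome i (refTime Tpre Tpost)] with ω h1 h2
  rw [h1, h2, h.beta_ref]
  ring

lemma abs_center_treatment_le (h : IsTWFEModel μ Y D β lam φ ε) (i : ℕ) (ω : Ω) :
    |center μ (D i) ω| ≤ 1 + |∫ ω', D i ω' ∂μ| :=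
  (abs_sub _ _).trans (add_le_add_left (h.abs_treatment_le i ω) _)

variable [IsProbabilityMeasure μ]

lemma integral_error (h : IsTWFEModel μ Y D β lam φ ε) (hD : ∀ i, Measurable (D i)) (i : ℕ)
    (t : TimeSpan Tpre Tpost) : ∫ ω, ε i t ω ∂μ = 0 := by
  rw [← integral_condExp (hD i).comap_le, integral_congr_ae (h.condExp_error i t)]
  simp

/-- The error is orthogonal to the centred treatment. -/
lemma integral_center_mul_error (h : IsTWFEModel μ Y D β lam φ ε) (hD : ∀ i, Measurable (D i))
    (i : ℕ) (t : TimeSpan Tpre Tpost) : ∫ ω, center μ (D i) ω * ε i t ω ∂μ = 0 := by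
  have hmeas : StronglyMeasurable[MeasurableSpace.comap (D i) inferInstance] (center μ (D i)) :=
    ((comap_measurable (D i)).sub_const _).stronglyMeasurable
  -- Boundedness of the treatment lets it be pulled out of the conditional expectation with ε merely
  -- integrable.
  have hpull := condExp_stronglyMeasurable_mul_of_bound (hD i).comap_le hmeas
    (h.integrable_error i t) _ (ae_of_all μ (h.abs_center_treatment_le i))
  change ∫ ω, (center μ (D i) * ε i t) ω ∂μ = 0
  rw [← integral_condExp (hD i).comap_le, integral_congr_ae hpull]
  refine integral_eq_zero_of_ae ?_
  filter_upwards [h.condExp_error i t] with ω hω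
  simp [hω]

/-- Asymptotic normality of the functional estimator. -/
theorem betaHat_asymptotics (hmodel : IsTWFEModel μ Y D β lam φ ε) (hiid : IsIIDSample μ Y D)
    (hoverlap : 0 < μ {ω | D 0 ω = 1} ∧ μ {ω | D 0 ω = 1} < 1)
    (hmomY : ∀ t, Integrable (fun ω => Y 0 t ω ^ 4) μ) (t : TimeSpan Tpre Tpost) :
    Integrable (scoreSq μ (D 0) (ε 0) t) μ ∧
      TendstoInDistribution
        (fun (n : ℕ) (ω : Ω) =>
          √(n : ℝ) * (betaHat n (fun i s => Y i s ω) (fun i => D i ω) t - β t))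
        atTop id (fun _ => μ) (gaussianReal 0 (asympVar μ (D 0) (ε 0) t).toNNReal) := by
  set r := refTime Tpre Tpost with hr
  set c : ℝ := φ t - φ r
  -- Defined from (Y, D) rather than ε: the i.i.d. assumption concerns only (Y, D), and U inherits
  -- it as a measurable function. The errors enter only for unit `0`, through an almost sure
  -- identity.
  let U : ℕ → Ω → ℝ := fun i ω => Y i t ω - Y i r ω - β t * D i ω - c
  have hDm := hiid.measurable_D
  have hUε : U 0 =ᵐ[μ] fun ω => ε 0 t ω - ε 0 r ω := hmodel.increment_error 0 t
  have hg : Measurable (fun z : (TimeSpan Tpre Tpost → ℝ) × ℝ =>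
      (z.2, z.1 t - z.1 r - β t * z.2 - c)) := by fun_prop
  have hindep : iIndepFun (fun i ω => (D i ω, U i ω)) μ := hiid.indep.comp (fun _ => _) fun _ => hg
  have hident : ∀ i, IdentDistrib (fun ω => (D i ω, U i ω)) (fun ω => (D 0 ω, U 0 ω)) μ μ :=
    fun i => (hiid.identDistrib i).comp hg
  have hD : MemLp (D 0) 2 μ := .of_bound (hDm 0).aestronglyMeasurable 1
    (ae_of_all _ fun ω => hmodel.abs_treatment_le 0 ω)
  have hY : ∀ u, MemLp (Y 0 u) 2 μ := fun u =>
    memLp_two_of_integrable_pow_four (hiid.measurable_Y 0 u).aestronglyMeasurable (hmomY u)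
  have hU : MemLp (U 0) 2 μ := (((hY t).sub (hY r)).sub (hD.const_mul (β t))).sub (memLp_const c)
  have hcm : Measurable (center μ (D 0)) := (hDm 0).sub_const _
  have hDU : MemLp (fun ω => center μ (D 0) ω * U 0 ω) 2 μ := by
    refine hU.of_le_mul (hcm.aestronglyMeasurable.mul hU.1) (c := 1 + |∫ ω', D 0 ω' ∂μ|)
      (ae_of_all _ fun ω => ?_)
    rw [norm_mul]
    exact mul_le_mul_of_nonneg_right (hmodel.abs_center_treatment_le 0 ω) (norm_nonneg _)
  have hU_mean : ∫ ω, U 0 ω ∂μ = 0 := by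
    rw [integral_congr_ae hUε,
      integral_sub (hmodel.integrable_error 0 t) (hmodel.integrable_error 0 r),
      hmodel.integral_error hDm, hmodel.integral_error hDm, sub_zero]
  have hint : ∀ u, Integrable (fun ω => center μ (D 0) ω * ε 0 u ω) μ := fun u =>
    (hmodel.integrable_error 0 u).bdd_mul hcm.aestronglyMeasurable
      (ae_of_all _ (hmodel.abs_center_treatment_le 0))
  have hDU_mean : ∫ ω, center μ (D 0) ω * U 0 ω ∂μ = 0 := by
    have : (fun ω => center μ (D 0) ω * U 0 ω) =ᵐ[μ]
        fun ω => center μ (D 0) ω * ε 0 t ω - center μ (D 0) ω * ε 0 r ω := by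
      filter_upwards [hUε] with ω hω
      rw [hω, mul_sub]
    rw [integral_congr_ae this, integral_sub (hint t) (hint r),
      hmodel.integral_center_mul_error hDm, hmodel.integral_center_mul_error hDm, sub_zero]
  have hscore : (fun ω => (center μ (D 0) ω * U 0 ω) ^ 2) =ᵐ[μ] scoreSq μ (D 0) (ε 0) t := by
    filter_upwards [hUε] with ω hω
    -- The errors already have mean zero, so the centring in `scoreSq` changes nothing.
    have hcε : ∀ u, center μ (ε 0 u) ω = ε 0 u ω := fun u => by
      rw [center, hmodel.integral_error hDm, sub_zero]
    simp only [scoreSq, hcε, hω, mul_pow, hr]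
  refine ⟨hDU.integrable_sq.congr hscore, ?_⟩
  have key := tendstoInDistribution_slope hindep hident hD hU hDU hU_mean hDU_mean
    (integral_center_sq_ne_zero hD hoverlap) (β t) c
  rw [asympVar, ← integral_congr_ae hscore]
  convert! key using 5 with n ω
  rw [betaHat_eq]
  congr 2
  ext i
  simp only [U, hr]
  ring

end IsTWFEModel

end Model

end EventStudy

theorem theorem3 {Ω : Type*} [MeasurableSpace Ω] (μ : Measure Ω) [IsProbabilityMeasure μ]
    (Tpre Tpost : ℕ)
    (Y : ℕ → EventStudy.TimeSpan Tpre Tpost → Ω → ℝ) (D : ℕ → Ω → ℝ)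
    (β : EventStudy.TimeSpan Tpre Tpost → ℝ) (lam : ℕ → Ω → ℝ)
    (φ : EventStudy.TimeSpan Tpre Tpost → ℝ)
    (ε : ℕ → EventStudy.TimeSpan Tpre Tpost → Ω → ℝ)
    (hmodel : EventStudy.IsTWFEModel μ Y D β lam φ ε)
    (hiid : EventStudy.IsIIDSample μ Y D)
    (hoverlap : 0 < μ {ω | D 0 ω = 1} ∧ μ {ω | D 0 ω = 1} < 1)
    (hmomY : ∀ t, Integrable (fun ω => Y 0 t ω ^ 4) μ)
    (hmomD : Integrable (fun ω => D 0 ω ^ 4) μ) :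
    (∀ t : EventStudy.TimeSpan Tpre Tpost,
      Integrable (EventStudy.scoreSq μ (D 0) (ε 0) t) μ ∧
      TendstoInDistribution
        (fun (n : ℕ) (ω : Ω) =>
          √(n : ℝ) * (EventStudy.betaHat n (fun i s => Y i s ω) (fun i => D i ω) t - β t))
        atTop id (fun _ => μ)
        (gaussianReal 0 (EventStudy.asympVar μ (D 0) (ε 0) t).toNNReal)) ∧
    (∀ t : EventStudy.PanelTime Tpre Tpost,
      TendstoInDistribution
        (fun (n : ℕ) (ω : Ω) =>
          √(n : ℝ) * (EventStudy.betaHatPD n (fun i s => Y i (EventStudy.PanelTime.toSpan s) ω)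
            (fun i => D i ω) t - β (EventStudy.PanelTime.toSpan t)))
        atTop id (fun _ => μ)
        (gaussianReal 0
          (EventStudy.asympVar μ (D 0) (ε 0) (EventStudy.PanelTime.toSpan t)).toNNReal)) := by
  have h := hmodel.betaHat_asymptotics hiid hoverlap hmomY
  refine ⟨h, fun t => ?_⟩
  simp only [fun n ω => EventStudy.betaHatPD_eq n (fun i s => Y i s ω) (fun i => D i ω) t]
  exact (h t.toSpan).2
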